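/- Let $(W,S)$ be a finite Coxeter group with simple reflections $S=(s_i)_{i\in I}$, length function $\ell$ and longest element $w_0$. Write $u\le_L v$ (left weak order) if some reduced word for $u$ is a right factor (suffix) of some reduced word for $v$, and $u\le_B v$ (Bruhat order) if some reduced word for $u$ is a subword of some reduced word for $v$; let $[u,v]_L$ and $[u,v]_B$ denote the corresponding intervals. For $i\in I$ define $\pi_i,\overline{\pi}_i:W\to W$, written as acting on the right, by $$w.\pi_i=\begin{cases} w & \text{if } \ell(ws_i)<\ell(w),\\ ws_i & \text{otherwise,}\end{cases}\qquad w.\overline{\pi}_i=\begin{cases} ws_i & \text{if } \ell(ws_i)<\ell(w),\\ w & \text{otherwise.}\end{cases}$$ The biHecke monoid $M(W)$ is the monoid of functions $W\to W$ generated by all $\pi_i$ and $\overline{\pi}_i$. For $v\in W$ put $\pi_v=\pi_{i_1}\cdots\pi_{i_k}$ and $\overline{\pi}_v=\overline{\pi}_{i_1}\cdots\overline{\pi}_{i_k}$, where $i_1\cdots i_k$ is any reduced word for $v$ and the leftmost operator acts first. For $w\in W$ let $$e_w:=\pi_{w^{-1}w_0}\,\overline{\pi}_{w_0w}\qquad(\pi_{w^{-1}w_0}\text{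 acting first}).$$ Then, for every $w\in W$, the function $e_w$ does not depend on the choice of reduced words, it is an idempotent of $M(W)$ with image set $[1,w]_L$, and it is the only idempotent of $M(W)$ with this image set. Moreover, for every $u\in W$, $$e_w(u)=\max_{\le_B}\bigl([1,u]_B\cap[1,w]_L\bigr),$$ that is, $e_w(u)$ belongs to $[1,u]_B\cap[1,w]_L$ and every element of this intersection is $\le_B e_w(u)$. -/

import Mathlib

namespace CoxeterSystem

/-- `w₀` is a longest element (in a finite Coxeter group there is exactly one). -/
def IsLongest {B W : Type*} [Group W] {M : CoxeterMatrix B} (cs : CoxeterSystem M W)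
    (w₀ : W) : Prop :=
  ∀ u : W, cs.length u ≤ cs.length w₀

/-- Left weak order: some reduced word for `u` is a right factor of some reduced word for `v`. -/
def LeftLE {B W : Type*} [Group W] {M : CoxeterMatrix B} (cs : CoxeterSystem M W)
    (u v : W) : Prop :=
  ∃ a b : List B, cs.IsReduced a ∧ cs.wordProd a = u ∧ cs.IsReduced b ∧ cs.wordProd b = v ∧
    a.IsSuffix b

/-- Bruhat order: some reduced word for `u` is a (not necessarily contiguous) subword of some
reduced word for `v`. -/
def BruhatLE {B W : Type*} [Group W] {M : CoxeterMatrix B} (cs : CoxeterSystem M W)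
    (u v : W) : Prop :=
  ∃ a b : List B, cs.IsReduced a ∧ cs.wordProd a = u ∧ cs.IsReduced b ∧ cs.wordProd b = v ∧
    a.Sublist b

/-- The interval `[u, v]_L` in left weak order. -/
def leftInterval {B W : Type*} [Group W] {M : CoxeterMatrix B} (cs : CoxeterSystem M W)
    (u v : W) : Set W :=
  {x | cs.LeftLE u x ∧ cs.LeftLE x v}

/-- The interval `[u, v]_B` in Bruhat order. -/
def bruhatInterval {B W : Type*} [Group W] {M : CoxeterMatrix B} (cs : CoxeterSystem M W)
    (u v : W) : Set W :=
  {x | cs.BruhatLE u x ∧ cs.BruhatLE x v}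

/-- `m` is the maximum of `A` for Bruhat order. -/
def IsBruhatMax {B W : Type*} [Group W] {M : CoxeterMatrix B} (cs : CoxeterSystem M W)
    (A : Set W) (m : W) : Prop :=
  m ∈ A ∧ ∀ x ∈ A, cs.BruhatLE x m

open Classical in
/-- The elementary antisorting operator `π_i`. -/
noncomputable def antisort {B W : Type*} [Group W] {M : CoxeterMatrix B}
    (cs : CoxeterSystem M W) (i : B) : Function.End W :=
  fun w => if cs.IsRightDescent w i then w else w * cs.simple i

open Classical in
/-- The elementary sorting operator `π̄_i`. -/
noncomputable def sort {B W : Type*} [Group W] {M : CoxeterMatrix B}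
    (cs : CoxeterSystem M W) (i : B) : Function.End W :=
  fun w => if cs.IsRightDescent w i then w * cs.simple i else w

/-- The operator `π_{i₁} ⋯ π_{iₖ}` of a word `i₁ … iₖ`. Operators act on the right, so the
leftmost letter acts first. -/
noncomputable def antisortWord {B W : Type*} [Group W] {M : CoxeterMatrix B}
    (cs : CoxeterSystem M W) (a : List B) : Function.End W :=
  fun u => a.foldl (fun x i => cs.antisort i x) u

/-- The operator `π̄_{i₁} ⋯ π̄_{iₖ}` of a word `i₁ … iₖ`, the leftmost letter acting first. -/
noncomputable def sortWord {B W : Type*} [Group W] {M : CoxeterMatrix B}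
    (cs : CoxeterSystem M W) (a : List B) : Function.End W :=
  fun u => a.foldl (fun x i => cs.sort i x) u

/-- A reduced word for `v`. -/
noncomputable def reducedWord {B W : Type*} [Group W] {M : CoxeterMatrix B}
    (cs : CoxeterSystem M W) (v : W) : List B :=
  (cs.exists_isReduced v).choose

theorem reducedWord_spec {B W : Type*} [Group W] {M : CoxeterMatrix B}
    (cs : CoxeterSystem M W) (v : W) :
    cs.IsReduced (cs.reducedWord v) ∧ cs.wordProd (cs.reducedWord v) = v :=
  ⟨(cs.exists_isReduced v).choose_spec.1, (cs.exists_isReduced v).choose_spec.2.symm⟩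

/-- The operator `π_v`. -/
noncomputable def antisortOf {B W : Type*} [Group W] {M : CoxeterMatrix B}
    (cs : CoxeterSystem M W) (v : W) : Function.End W :=
  cs.antisortWord (cs.reducedWord v)

/-- The operator `π̄_v`. -/
noncomputable def sortOf {B W : Type*} [Group W] {M : CoxeterMatrix B}
    (cs : CoxeterSystem M W) (v : W) : Function.End W :=
  cs.sortWord (cs.reducedWord v)

/-- The biHecke monoid `M(W)`: the monoid of functions from `W` to `W` generated by all the
`π_i` and `π̄_i`. (`Function.End` multiplies by `f * g = f ∘ g`, opposite to the convention of
operators acting on the right; the generated set of functions and its idempotents are the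
same.) -/
noncomputable def biHecke {B W : Type*} [Group W] {M : CoxeterMatrix B}
    (cs : CoxeterSystem M W) : Submonoid (Function.End W) :=
  Submonoid.closure (Set.range cs.antisort ∪ Set.range cs.sort)

/-- `e_w = π_{w⁻¹ w₀} π̄_{w₀ w}`, the left factor acting first. -/
noncomputable def biHeckeIdem {B W : Type*} [Group W] {M : CoxeterMatrix B}
    (cs : CoxeterSystem M W) (w₀ w : W) : Function.End W :=
  fun u => cs.sortOf (w₀ * w) (cs.antisortOf (w⁻¹ * w₀) u)

end CoxeterSystem

namespace CoxeterSystem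

open List

variable {B W : Type*} [Group W] {M : CoxeterMatrix B} (cs : CoxeterSystem M W)

/-! ### The reflection cocycle and the strong exchange property -/

/-! Every `f` in the monoid is rigid in two ways. It maps each edge `w`, `s_i w` of left weak order
to a point or to an edge with the same label, and it preserves Bruhat order. If moreover `f 1 = 1`,
following a reduced word up from `1` shows that `f u` is obtained by deleting letters, so `f u ≤_B
u` (`PreservesLeftEdges.bruhatLE`).

An idempotent with image `[1,w]_L` fixes that interval pointwise, in particular `1`. Hence `f u`
lies in `[1,u]_B ∩ [1,w]_L`, and any `x` there satisfies `x = f x ≤_B f u`. So `f u` is the Bruhat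
maximum, which determines `f`. Uniqueness and independence of reduced words both follow.

For existence, `e_w` sends `w₀` to `w`, so its image lies in `[1,w]_L` because `w₀` is the top of
left weak order. An element `x ≤_L w` climbs along all of `w⁻¹w₀` and descends back to itself along
`w₀w`.

The Coxeter-theoretic input is strong exchange, obtained from a sign cocycle counting inversions
modulo 2. -/

open Classical in
/-- Conjugation by a simple reflection, together with a sign change at that reflection. -/
noncomputable def simplePerm (i : B) : Equiv.Perm (W × ZMod 2) :=
  Function.Involutive.toPerm
    (fun p => (cs.simple i * p.1 * cs.simple i, p.2 + if p.1 = cs.simple i then 1 else 0)) (by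
      rintro ⟨t, e⟩
      have h : cs.simple i * t * cs.simple i = cs.simple i ↔ t = cs.simple i := by
        constructor
        · intro h
          have := congrArg (fun x => cs.simple i * x * cs.simple i) h
          simpa [mul_assoc] using this
        · rintro rfl; simp
      ext
      · simp [mul_assoc]
      · simp only [h]
        split_ifs
        · rw [add_assoc, (by decide : (1 + 1 : ZMod 2) = 0), add_zero]
        · simp)

open Classical in
theorem simplePerm_apply (i : B) (t : W) (e : ZMod 2) :
    cs.simplePerm i (t, e) =
      (cs.simple i * t * cs.simple i, e + if t = cs.simple i then 1 else 0) := rfl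

open Classical in
theorem prod_simplePerm_apply (ω : List B) (t : W) (e : ZMod 2) :
    (ω.map cs.simplePerm).prod (t, e) =
      (cs.wordProd ω * t * (cs.wordProd ω)⁻¹, e + ((cs.rightInvSeq ω).count t : ZMod 2)) := by
  induction ω with
  | nil => simp
  | cons i ω ih =>
    rw [map_cons, prod_cons, Equiv.Perm.mul_apply, ih, simplePerm_apply, rightInvSeq, count_cons,
      wordProd_cons]
    have h : cs.wordProd ω * t * (cs.wordProd ω)⁻¹ = cs.simple i ↔
        (cs.wordProd ω)⁻¹ * cs.simple i * cs.wordProd ω = t := by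
      constructor
      · intro h; rw [← h]; group
      · intro h; rw [← h]; group
    ext
    · simp [mul_assoc]
    · simp only [h, beq_iff_eq]
      split_ifs <;> simp [add_assoc]

theorem prod_map_alternatingWord {G : Type*} [Monoid G] (f : B → G) (i j : B) (m : ℕ) :
    ((alternatingWord i j (2 * m)).map f).prod = (f i * f j) ^ m := by
  induction m with
  | zero => simp [alternatingWord]
  | succ m ih =>
    rw [show 2 * (m + 1) = 2 * m + 1 + 1 by ring, alternatingWord_succ, alternatingWord_succ,
      pow_succ, ← ih]
    simp

/-- The `k`-th entry is an alternating product of length `2k + 1`, which depends only on `k` modulo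
`M i j`. Each reflection thus occurs an even number of times, so the signs cancel along a braid
relation. -/
theorem leftInvSeq_braidWord_two_mul (i j : B) :
    ∃ l, cs.leftInvSeq (alternatingWord i j (2 * M i j)) = l ++ l := by
  set L := cs.leftInvSeq (alternatingWord i j (2 * M i j)) with hL
  have hlen : L.length = 2 * M i j := by simp [hL]
  refine ⟨L.take (M i j), ?_⟩
  nth_rw 1 [← take_append_drop (M i j) L]
  congr 1
  apply ext_getElem
  · simp [hlen]; lia
  · intro k h₁ h₂
    have hk : k < M i j := by simp [hlen] at h₁; lia
    rw [getElem_drop, getElem_take]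
    simp only [hL]
    rw [cs.getElem_leftInvSeq_alternatingWord i j _ _ (by lia),
      cs.getElem_leftInvSeq_alternatingWord i j _ _ (by lia)]
    rw [prod_alternatingWord_eq_mul_pow, prod_alternatingWord_eq_mul_pow]
    have e₁ : (2 * (M i j + k) + 1) / 2 = M i j + k := by lia
    have e₂ : (2 * k + 1) / 2 = k := by lia
    have e₃ : ¬ Even (2 * (M i j + k) + 1) := by simp
    have e₄ : ¬ Even (2 * k + 1) := by simp
    rw [e₁, e₂, if_neg e₃, if_neg e₄, pow_add, simple_mul_simple_pow', one_mul]

theorem isLiftable_simplePerm : M.IsLiftable cs.simplePerm := by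
  classical
  intro i j
  rw [← prod_map_alternatingWord]
  ext1 ⟨t, e⟩
  rw [prod_simplePerm_apply]
  have h1 : cs.wordProd (alternatingWord i j (2 * M i j)) = 1 := by
    rw [wordProd, prod_map_alternatingWord, simple_mul_simple_pow]
  have h2 : ((cs.rightInvSeq (alternatingWord i j (2 * M i j))).count t : ZMod 2) = 0 := by
    obtain ⟨l, hl⟩ := cs.leftInvSeq_braidWord_two_mul j i
    have hrev : alternatingWord i j (2 * M i j) = (alternatingWord j i (2 * M j i)).reverse := by
      rw [M.symmetric j i]
      apply ext_getElem
      · simp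
      · intro k h₁ h₂
        simp only [length_alternatingWord] at h₁
        rw [getElem_reverse, getElem_alternatingWord _ _ _ _ h₁]
        simp only [length_alternatingWord]
        rw [getElem_alternatingWord _ _ _ _ (by lia)]
        have : Even (2 * M i j + (2 * M i j - 1 - k)) ↔ ¬ Even (2 * M i j + k) := by
          simp only [Nat.even_iff]; lia
        simp only [this]
        split_ifs <;> simp_all
    rw [hrev, rightInvSeq_reverse, count_reverse, hl, count_append, Nat.cast_add]
    exact CharTwo.add_self_eq_zero _
  rw [h1, h2]
  simp

/-- The action of `W` on signed elements of `W` by conjugation. -/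
noncomputable def signedConj : W →* Equiv.Perm (W × ZMod 2) :=
  cs.lift ⟨cs.simplePerm, cs.isLiftable_simplePerm⟩

open Classical in
theorem signedConj_wordProd_apply (ω : List B) (t : W) (e : ZMod 2) :
    cs.signedConj (cs.wordProd ω) (t, e) =
      (cs.wordProd ω * t * (cs.wordProd ω)⁻¹, e + ((cs.rightInvSeq ω).count t : ZMod 2)) := by
  rw [← prod_simplePerm_apply, wordProd, map_list_prod, map_map]
  congr 3
  ext1 i
  exact cs.lift_apply_simple cs.isLiftable_simplePerm i

/-- The parity of the number of occurrences of `t` in the right inversion sequence of any word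
for `w`. -/
noncomputable def inversionParity (w t : W) : ZMod 2 := (cs.signedConj w (t, 0)).2

open Classical in
theorem inversionParity_wordProd (ω : List B) (t : W) :
    cs.inversionParity (cs.wordProd ω) t = ((cs.rightInvSeq ω).count t : ZMod 2) := by
  rw [inversionParity, signedConj_wordProd_apply, zero_add]

theorem signedConj_apply (w t : W) (e : ZMod 2) :
    cs.signedConj w (t, e) = (w * t * w⁻¹, e + cs.inversionParity w t) := by
  obtain ⟨ω, rfl⟩ := cs.wordProd_surjective w
  rw [inversionParity, signedConj_wordProd_apply, signedConj_wordProd_apply, zero_add]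

theorem inversionParity_mul (w x t : W) :
    cs.inversionParity (w * x) t =
      cs.inversionParity w (x * t * x⁻¹) + cs.inversionParity x t := by
  rw [inversionParity, map_mul, Equiv.Perm.mul_apply, signedConj_apply, signedConj_apply]
  simp [add_comm]

@[simp]
theorem inversionParity_one (t : W) : cs.inversionParity 1 t = 0 := by
  simp [inversionParity]

theorem inversionParity_simple_self (i : B) :
    cs.inversionParity (cs.simple i) (cs.simple i) = 1 := by
  classical
  rw [← cs.wordProd_singleton i, inversionParity_wordProd]
  simp

/-- In the cocycle expansion of `u s u⁻¹` the contributions of `u` and `u⁻¹` cancel, since they add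
up to the parity of `u u⁻¹ = 1`. Only the contribution of `s` remains. -/
theorem IsReflection.inversionParity_self {cs : CoxeterSystem M W} {t : W}
    (ht : cs.IsReflection t) : cs.inversionParity t t = 1 := by
  obtain ⟨u, i, rfl⟩ := ht
  have h := cs.inversionParity_mul u u⁻¹ (u * cs.simple i * u⁻¹)
  rw [mul_inv_cancel, inversionParity_one,
    show u⁻¹ * (u * cs.simple i * u⁻¹) * u⁻¹⁻¹ = cs.simple i by group] at h
  rw [inversionParity_mul, inversionParity_mul,
    show u⁻¹ * (u * cs.simple i * u⁻¹) * u⁻¹⁻¹ = cs.simple i by group,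
    show cs.simple i * cs.simple i * (cs.simple i)⁻¹ = cs.simple i by group,
    inversionParity_simple_self, add_right_comm, ← h, zero_add]

theorem mem_rightInvSeq_of_inversionParity {ω : List B} {t : W}
    (h : cs.inversionParity (cs.wordProd ω) t = 1) : t ∈ cs.rightInvSeq ω := by
  classical
  rw [inversionParity_wordProd] at h
  by_contra hn
  rw [count_eq_zero_of_not_mem hn] at h
  simp at h

theorem isRightInversion_of_inversionParity {w t : W} (h : cs.inversionParity w t = 1) :
    cs.IsRightInversion w t := by
  obtain ⟨ω, hω, rfl⟩ := cs.exists_isReduced w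
  exact cs.isRightInversion_of_mem_rightInvSeq hω (cs.mem_rightInvSeq_of_inversionParity h)

/-- For the converse: if `w` had parity 0 at `t`, the cocycle rule would give `w * t` parity 1,
making `t` an inversion of both `w` and `w * t`. -/
theorem inversionParity_eq_one_iff {w t : W} :
    cs.inversionParity w t = 1 ↔ cs.IsRightInversion w t := by
  refine ⟨cs.isRightInversion_of_inversionParity, fun h => ?_⟩
  by_contra hn
  have h0 : cs.inversionParity w t = 0 := by
    generalize cs.inversionParity w t = x at hn
    revert hn; revert x; decide
  have h1 : cs.inversionParity (w * t) t = 1 := by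
    rw [inversionParity_mul, h.1.inversionParity_self, mul_inv_cancel_right, h0, zero_add]
  exact h.1.isRightInversion_mul_left_iff.1 (cs.isRightInversion_of_inversionParity h1) h

/-- The strong exchange property. -/
theorem strong_exchange {ω : List B} {t : W} (h : cs.IsRightInversion (cs.wordProd ω) t) :
    ∃ j < ω.length, cs.wordProd ω * t = cs.wordProd (ω.eraseIdx j) := by
  have hmem := cs.mem_rightInvSeq_of_inversionParity (cs.inversionParity_eq_one_iff.2 h)
  obtain ⟨j, hj, rfl⟩ := mem_iff_getElem.1 hmem
  refine ⟨j, by simpa using hj, ?_⟩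
  rw [← cs.wordProd_mul_getD_rightInvSeq, getD_eq_getElem _ _ hj]

theorem exchange {ω : List B} {i : B} (h : cs.IsRightDescent (cs.wordProd ω) i) :
    ∃ j < ω.length, cs.wordProd ω * cs.simple i = cs.wordProd (ω.eraseIdx j) :=
  cs.strong_exchange ((cs.isRightInversion_simple_iff_isRightDescent _ i).2 h)

theorem isReduced_concat {ω : List B} (hω : cs.IsReduced ω) {i : B}
    (h : ¬ cs.IsRightDescent (cs.wordProd ω) i) : cs.IsReduced (ω ++ [i]) := by
  rw [not_isRightDescent_iff, hω.eq] at h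
  simp [IsReduced, wordProd_append, h]

theorem exists_isReduced_sublist (ω : List B) :
    ∃ a : List B, cs.IsReduced a ∧ cs.wordProd a = cs.wordProd ω ∧ a <+ ω := by
  induction ω using List.reverseRecOn with
  | nil => exact ⟨[], by simp [IsReduced], rfl, Sublist.refl _⟩
  | append_singleton ω i ih =>
    obtain ⟨a, ha, hp, hs⟩ := ih
    by_cases h : cs.IsRightDescent (cs.wordProd a) i
    · obtain ⟨j, hj, he⟩ := cs.exchange h
      refine ⟨a.eraseIdx j, ?_, ?_, ?_⟩
      · have := (cs.isRightDescent_iff).1 h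
        rw [he, ha.eq, ← length_eraseIdx_add_one hj] at this
        rw [IsReduced]; lia
      · rw [← he, hp, wordProd_append, wordProd_singleton]
      · exact (eraseIdx_sublist _ _).trans (hs.trans (sublist_append_left _ _))
    · exact ⟨a ++ [i], cs.isReduced_concat ha h, by simp [wordProd_append, hp],
        hs.append_right [i]⟩

/-- Exchange deletes a letter from `i` followed by a reduced word of `w`. Deleting inside the word
of `w` would make `w s_j` shorter than `w`, so the deleted letter is the leading `i`. -/
theorem simple_mul_eq_mul_simple {w : W} {i j : B} (hi : ¬ cs.IsLeftDescent w i)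
    (hj : ¬ cs.IsRightDescent w j) (h : cs.IsRightDescent (cs.simple i * w) j) :
    cs.simple i * w = w * cs.simple j := by
  obtain ⟨ω, hω, rfl⟩ := cs.exists_isReduced w
  rw [← wordProd_cons] at h
  obtain ⟨k, hk, he⟩ := cs.exchange h
  cases k with
  | zero =>
    rw [eraseIdx_cons_zero, wordProd_cons] at he
    nth_rw 1 [← he]
    rw [mul_assoc, simple_mul_simple_cancel_left]
  | succ k =>
    exfalso
    rw [eraseIdx_cons_succ, wordProd_cons, wordProd_cons, mul_assoc, mul_right_inj] at he
    rw [not_isRightDescent_iff, he, hω.eq] at hj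
    have := cs.length_wordProd_le (ω.eraseIdx k)
    have := (eraseIdx_sublist ω k).length_le
    lia

/-! ### Bruhat order as reachability by reflections -/

/-- `v` is obtained from `u` by a right multiplication by a reflection that increases length. -/
def BruhatStep (u v : W) : Prop :=
  ∃ t, cs.IsRightInversion v t ∧ u = v * t

/-- The reflexive transitive closure of `BruhatStep`. -/
def BruhatChain : W → W → Prop := Relation.ReflTransGen cs.BruhatStep

theorem BruhatStep.length_lt {cs : CoxeterSystem M W} {u v : W} (h : cs.BruhatStep u v) :
    cs.length u < cs.length v := by
  obtain ⟨t, ht, rfl⟩ := h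
  exact ht.2

theorem bruhatStep_of_isRightDescent {w : W} {i : B} (h : cs.IsRightDescent w i) :
    cs.BruhatStep (w * cs.simple i) w :=
  ⟨cs.simple i, (cs.isRightInversion_simple_iff_isRightDescent w i).2 h, rfl⟩

theorem bruhatStep_of_not_isRightDescent {w : W} {i : B} (h : ¬ cs.IsRightDescent w i) :
    cs.BruhatStep w (w * cs.simple i) := by
  rw [isRightDescent_iff_not_isRightDescent_mul, not_not] at h
  simpa using cs.bruhatStep_of_isRightDescent h

theorem bruhatStep_mul_simple {u v : W} (h : cs.BruhatStep u v) (i : B)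
    (hl : cs.length (u * cs.simple i) < cs.length (v * cs.simple i)) :
    cs.BruhatStep (u * cs.simple i) (v * cs.simple i) := by
  obtain ⟨t, ht, rfl⟩ := h
  have e : v * t * cs.simple i
      = v * cs.simple i * (cs.simple i * t * (cs.simple i)⁻¹) := by simp [mul_assoc]
  exact ⟨_, ⟨ht.1.conj _, e ▸ hl⟩, e⟩

/-- The lifting property. If `v s` is not longer than `u s`, it is strictly shorter, as the two
differ by a reflection. Strong exchange then deletes a letter from a word of `u` followed by `s`; it
must be the final `s`, since otherwise `v` would be shorter than `u`. -/
theorem bruhatStep_lift {u v : W} (h : cs.BruhatStep u v) {i : B}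
    (hu : ¬ cs.IsRightDescent u i) :
    u * cs.simple i = v ∨ cs.BruhatStep (u * cs.simple i) (v * cs.simple i) := by
  by_cases hl : cs.length (u * cs.simple i) < cs.length (v * cs.simple i)
  · exact .inr (cs.bruhatStep_mul_simple h i hl)
  left
  have huv := h.length_lt
  obtain ⟨t, ht, rfl⟩ := h
  have hr := ht.1.conj (cs.simple i)
  set u := v * t with hu'
  have e : v * cs.simple i = u * cs.simple i * (cs.simple i * t * (cs.simple i)⁻¹) := by
    rw [hu']
    simp only [mul_assoc, inv_simple, simple_mul_simple_cancel_left]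
    rw [← mul_assoc t t, ht.1.mul_self, one_mul]
  have hne := hr.length_mul_left_ne (u * cs.simple i)
  rw [← e] at hne
  obtain ⟨ω, hω, hωu⟩ := cs.exists_isReduced u
  have hinv : cs.IsRightInversion (cs.wordProd (ω ++ [i]))
      (cs.simple i * t * (cs.simple i)⁻¹) := by
    refine ⟨hr, ?_⟩
    rw [wordProd_append, wordProd_singleton, ← hωu, ← e]
    lia
  obtain ⟨j, hj, he⟩ := cs.strong_exchange hinv
  rw [wordProd_append, wordProd_singleton, ← hωu, ← e] at he
  by_cases hjω : j < ω.length
  · exfalso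
    rw [eraseIdx_append_of_lt_length hjω, wordProd_append, wordProd_singleton, mul_left_inj] at he
    have h1 := cs.length_wordProd_le (ω.eraseIdx j)
    have h2 := (eraseIdx_sublist ω j).length_le
    rw [← he] at h1
    rw [← hω.eq, ← hωu] at h2
    lia
  · have : j = ω.length := by simp at hj; lia
    subst this
    rw [eraseIdx_append_of_length_le le_rfl] at he
    simp only [Nat.sub_self, eraseIdx_cons_zero, append_nil] at he
    rw [hωu, ← he]
    simp

theorem BruhatStep.antisort {cs : CoxeterSystem M W} {u v : W} (h : cs.BruhatStep u v) (i : B) :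
    cs.BruhatChain (cs.antisort i u) (cs.antisort i v) := by
  unfold CoxeterSystem.antisort
  by_cases hu : cs.IsRightDescent u i <;> by_cases hv : cs.IsRightDescent v i
  · simp only [hu, hv, if_true]
    exact Relation.ReflTransGen.single h
  · simp only [hu, hv, if_true, if_false]
    exact (Relation.ReflTransGen.single h).tail
      (cs.bruhatStep_of_not_isRightDescent hv)
  · simp only [hu, hv, if_true, if_false]
    rcases cs.bruhatStep_lift h hu with h' | h'
    · rw [h']; exact Relation.ReflTransGen.refl
    · exact (Relation.ReflTransGen.single h').tail (cs.bruhatStep_of_isRightDescent hv)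
  · simp only [hu, hv, if_false]
    refine Relation.ReflTransGen.single (cs.bruhatStep_mul_simple h i ?_)
    rw [not_isRightDescent_iff] at hu hv
    have := h.length_lt
    lia

theorem BruhatStep.sort {cs : CoxeterSystem M W} {u v : W} (h : cs.BruhatStep u v) (i : B) :
    cs.BruhatChain (cs.sort i u) (cs.sort i v) := by
  unfold CoxeterSystem.sort
  by_cases hu : cs.IsRightDescent u i <;> by_cases hv : cs.IsRightDescent v i
  · simp only [hu, hv, if_true]
    refine Relation.ReflTransGen.single (cs.bruhatStep_mul_simple h i ?_)
    rw [isRightDescent_iff] at hu hv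
    have := h.length_lt
    lia
  · simp only [hu, hv, if_true, if_false]
    exact (Relation.ReflTransGen.single h).head
      (cs.bruhatStep_of_isRightDescent hu)
  · simp only [hu, hv, if_true, if_false]
    rcases cs.bruhatStep_lift h hu with h' | h'
    · rw [← h', simple_mul_simple_cancel_right]; exact Relation.ReflTransGen.refl
    · exact (Relation.ReflTransGen.single h').head (cs.bruhatStep_of_not_isRightDescent hu)
  · simp only [hu, hv, if_false]
    exact Relation.ReflTransGen.single h

theorem BruhatChain.map {cs : CoxeterSystem M W} {f : W → W}
    (hf : ∀ u v, cs.BruhatStep u v → cs.BruhatChain (f u) (f v)) {u v : W}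
    (h : cs.BruhatChain u v) : cs.BruhatChain (f u) (f v) := by
  induction h with
  | refl => exact Relation.ReflTransGen.refl
  | tail _ h ih => exact ih.trans (hf _ _ h)

theorem isReduced_of_concat {a : List B} {i : B} (h : cs.IsReduced (a ++ [i])) :
    cs.IsReduced a ∧ ¬ cs.IsRightDescent (cs.wordProd a) i := by
  have ha : cs.IsReduced a := by simpa using h.take a.length
  refine ⟨ha, ?_⟩
  rw [not_isRightDescent_iff, ha.eq]
  simpa [IsReduced, wordProd_append] using h

theorem bruhatChain_wordProd {a b : List B} (ha : cs.IsReduced a) (hb : cs.IsReduced b)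
    (hab : a <+ b) : cs.BruhatChain (cs.wordProd a) (cs.wordProd b) := by
  induction b using List.reverseRecOn generalizing a with
  | nil => rw [sublist_nil.1 hab]; exact Relation.ReflTransGen.refl
  | append_singleton b i ih =>
    obtain ⟨hb', hbi⟩ := cs.isReduced_of_concat hb
    obtain ⟨a', c, rfl, ha', hc⟩ := sublist_append_iff.1 hab
    rcases sublist_singleton.1 hc with rfl | rfl
    · rw [append_nil] at *
      refine (ih ha hb' ha').tail ?_
      simpa [wordProd_append] using cs.bruhatStep_of_not_isRightDescent hbi
    -- When both words end in `i`, restoring this letter amounts to applying the monotone map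
    -- `antisort i` to both sides.
    · obtain ⟨hra, hai⟩ := cs.isReduced_of_concat ha
      have := (ih hra hb' ha').map (fun _ _ h => h.antisort i)
      simpa [CoxeterSystem.antisort, hai, hbi, wordProd_append] using this

/-- Each step down deletes a letter by strong exchange, and the remaining word is thinned to a
reduced one. The word `b` is arbitrary, so the subword criterion does not depend on its choice. -/
theorem BruhatChain.exists_sublist {cs : CoxeterSystem M W} {u v : W} (h : cs.BruhatChain u v)
    {b : List B} (hb : cs.IsReduced b) (hv : cs.wordProd b = v) :
    ∃ a : List B, cs.IsReduced a ∧ cs.wordProd a = u ∧ a <+ b := by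
  induction h using Relation.ReflTransGen.head_induction_on with
  | refl => exact ⟨b, hb, hv, Sublist.refl _⟩
  | head h _ ih =>
    obtain ⟨a, -, rfl, hs⟩ := ih
    obtain ⟨t, ht, rfl⟩ := h
    obtain ⟨j, -, he⟩ := cs.strong_exchange ht
    obtain ⟨c, hc, hcp, hcs⟩ := cs.exists_isReduced_sublist (a.eraseIdx j)
    exact ⟨c, hc, hcp.trans he.symm, (hcs.trans (eraseIdx_sublist _ _)).trans hs⟩

theorem bruhatLE_iff_bruhatChain {u v : W} : cs.BruhatLE u v ↔ cs.BruhatChain u v := by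
  constructor
  · rintro ⟨a, b, ha, rfl, hb, rfl, hab⟩
    exact cs.bruhatChain_wordProd ha hb hab
  · intro h
    obtain ⟨b, hb, hv⟩ := cs.exists_isReduced v
    obtain ⟨a, ha, hu, hab⟩ := h.exists_sublist hb hv.symm
    exact ⟨a, b, ha, hu, hb, hv.symm, hab⟩

theorem BruhatLE.antisymm {cs : CoxeterSystem M W} {u v : W} (h : cs.BruhatLE u v)
    (h' : cs.BruhatLE v u) : u = v := by
  obtain ⟨a, b, ha, rfl, hb, rfl, hab⟩ := h
  obtain ⟨c, d, hc, hcv, hd, hdu, hcd⟩ := h'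
  have := hcd.length_le
  rw [← hc.eq, ← hd.eq, hcv, hdu, ha.eq, hb.eq] at this
  rw [hab.eq_of_length_le this]

theorem one_bruhatLE (u : W) : cs.BruhatLE 1 u := by
  obtain ⟨b, hb, hu⟩ := cs.exists_isReduced u
  exact ⟨[], b, by simp [IsReduced], by simp, hb, hu.symm, nil_sublist _⟩

theorem IsBruhatMax.unique {cs : CoxeterSystem M W} {A : Set W} {m m' : W}
    (h : cs.IsBruhatMax A m) (h' : cs.IsBruhatMax A m') : m = m' :=
  (h'.2 m h.1).antisymm (h.2 m' h'.1)

/-! ### Left weak order -/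

theorem leftLE_iff {u v : W} :
    cs.LeftLE u v ↔ cs.length (v * u⁻¹) + cs.length u = cs.length v := by
  constructor
  · rintro ⟨a, b, ha, rfl, hb, rfl, c, rfl⟩
    have hc : cs.IsReduced c := by simpa using hb.take c.length
    rw [wordProd_append, mul_inv_cancel_right, ← wordProd_append, hc.eq, ha.eq, hb.eq,
      length_append]
  · intro h
    obtain ⟨a, ha, hu⟩ := cs.exists_isReduced u
    obtain ⟨c, hc, hvu⟩ := cs.exists_isReduced (v * u⁻¹)
    have hp : cs.wordProd (c ++ a) = v := by rw [wordProd_append, ← hu, ← hvu]; simp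
    refine ⟨a, c ++ a, ha, hu.symm, ?_, hp, suffix_append _ _⟩
    rw [IsReduced, hp, length_append, ← h, ← hc.eq, ← ha.eq, ← hvu, ← hu]

theorem one_leftLE (u : W) : cs.LeftLE 1 u := by simp [leftLE_iff]

/-- `f` maps every edge of the left weak order to a point or to an edge with the same label. -/
def PreservesLeftEdges (f : W → W) : Prop :=
  ∀ (w : W) (i : B), ¬ cs.IsLeftDescent w i → f (cs.simple i * w) = f w ∨
    (f (cs.simple i * w) = cs.simple i * f w ∧ ¬ cs.IsLeftDescent (f w) i)

theorem isRightDescent_simple_mul {w : W} {i j : B} (hi : ¬ cs.IsLeftDescent w i)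
    (hj : cs.IsRightDescent w j) : cs.IsRightDescent (cs.simple i * w) j := by
  rw [not_isLeftDescent_iff] at hi
  rw [isRightDescent_iff] at hj
  rw [IsRightDescent, mul_assoc, hi]
  have := cs.length_simple_mul (w * cs.simple j) i
  lia

theorem not_isLeftDescent_mul_simple {w : W} {i j : B} (hi : ¬ cs.IsLeftDescent w i)
    (hj : cs.IsRightDescent w j ↔ cs.IsRightDescent (cs.simple i * w) j) :
    ¬ cs.IsLeftDescent (w * cs.simple j) i := by
  rw [not_isLeftDescent_iff] at hi ⊢
  rw [← mul_assoc]
  by_cases h : cs.IsRightDescent w j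
  · have h' := hj.1 h
    rw [isRightDescent_iff] at h h'
    lia
  · have h' : ¬ cs.IsRightDescent (cs.simple i * w) j := fun h' => h (hj.2 h')
    rw [not_isRightDescent_iff] at h h'
    lia

/-- Going up a left edge keeps right descents. If `j` becomes a descent only at the upper end, then
`s_i w = w s_j` and the edge collapses; otherwise `j` acts alike on both ends. -/
theorem preservesLeftEdges_antisort (j : B) : cs.PreservesLeftEdges (cs.antisort j) := by
  intro w i hi
  unfold antisort
  by_cases hj : cs.IsRightDescent w j
  · have h' := cs.isRightDescent_simple_mul hi hj
    simp [hj, h', hi]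
  · by_cases h' : cs.IsRightDescent (cs.simple i * w) j
    · left
      simp only [hj, h', if_true, if_false]
      rw [cs.simple_mul_eq_mul_simple hi hj h']
    · right
      simpa [hj, h', mul_assoc] using
        cs.not_isLeftDescent_mul_simple hi (j := j) (by simp [hj, h'])

theorem preservesLeftEdges_sort (j : B) : cs.PreservesLeftEdges (cs.sort j) := by
  intro w i hi
  unfold sort
  by_cases hj : cs.IsRightDescent w j
  · have h' := cs.isRightDescent_simple_mul hi hj
    right
    simpa [hj, h', mul_assoc] using
      cs.not_isLeftDescent_mul_simple hi (j := j) (by simp [hj, h'])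
  · by_cases h' : cs.IsRightDescent (cs.simple i * w) j
    · left
      simp only [hj, h', if_true, if_false]
      rw [cs.simple_mul_eq_mul_simple hi hj h', simple_mul_simple_cancel_right]
    · simp [hj, h', hi]

theorem PreservesLeftEdges.comp {cs : CoxeterSystem M W} {f g : W → W}
    (hf : cs.PreservesLeftEdges f) (hg : cs.PreservesLeftEdges g) :
    cs.PreservesLeftEdges (f ∘ g) := by
  intro w i hi
  rcases hg w i hi with h | ⟨h, h'⟩
  · simp [h]
  · simpa [h] using hf (g w) i h'

/-- The word `a` labels an ascending path from `u`; its image is an ascending path from `f u` whose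
labels are those of the edges that `f` does not contract. -/
theorem PreservesLeftEdges.exists_sublist {cs : CoxeterSystem M W} {f : W → W}
    (hf : cs.PreservesLeftEdges f) (u : W) (a : List B)
    (ha : cs.length (cs.wordProd a * u) = a.length + cs.length u) :
    ∃ c, c <+ a ∧ f (cs.wordProd a * u) = cs.wordProd c * f u ∧
      cs.length (cs.wordProd c * f u) = c.length + cs.length (f u) := by
  induction a with
  | nil => exact ⟨[], by simp⟩
  | cons i a ih =>
    rw [wordProd_cons, mul_assoc, length_cons] at ha
    have h1 := cs.length_mul_le (cs.wordProd a) u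
    have h2 := cs.length_wordProd_le a
    have h3 := cs.length_simple_mul (cs.wordProd a * u) i
    obtain ⟨c, hc, he, hl⟩ := ih (by lia)
    have hi : ¬ cs.IsLeftDescent (cs.wordProd a * u) i := by rw [IsLeftDescent]; lia
    rcases hf _ i hi with h | ⟨h, h'⟩
    · exact ⟨c, hc.cons i, by rw [wordProd_cons, mul_assoc, h, he], hl⟩
    · refine ⟨i :: c, hc.cons_cons i, ?_, ?_⟩
      · rw [wordProd_cons, wordProd_cons, mul_assoc, h, he, mul_assoc]
      · rw [not_isLeftDescent_iff, he, hl] at h'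
        rw [wordProd_cons, mul_assoc, h', length_cons]
        lia

theorem PreservesLeftEdges.leftLE {cs : CoxeterSystem M W} {f : W → W}
    (hf : cs.PreservesLeftEdges f) {u v : W} (h : cs.LeftLE u v) : cs.LeftLE (f u) (f v) := by
  rw [leftLE_iff] at h ⊢
  obtain ⟨a, ha, he⟩ := cs.exists_isReduced (v * u⁻¹)
  obtain rfl : v = cs.wordProd a * u := by rw [← he]; simp
  rw [mul_inv_cancel_right, ha.eq] at h
  obtain ⟨c, -, hc, hl⟩ := hf.exists_sublist u a h.symm
  rw [hc, mul_inv_cancel_right]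
  have h1 := cs.length_mul_le (cs.wordProd c) (f u)
  have h2 := cs.length_wordProd_le c
  lia

theorem PreservesLeftEdges.bruhatLE {cs : CoxeterSystem M W} {f : W → W}
    (hf : cs.PreservesLeftEdges f) (h1 : f 1 = 1) (u : W) : cs.BruhatLE (f u) u := by
  obtain ⟨a, ha, rfl⟩ := cs.exists_isReduced u
  obtain ⟨c, hca, hc, hl⟩ := hf.exists_sublist 1 a (by simpa using ha.eq)
  simp only [h1, mul_one, length_one, add_zero] at hc hl
  exact ⟨c, a, hl, hc.symm, ha, rfl, hca⟩

/-! ### The biHecke monoid -/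

theorem preservesLeftEdges_of_mem_biHecke {f : Function.End W} (hf : f ∈ cs.biHecke) :
    cs.PreservesLeftEdges f := by
  induction hf using Submonoid.closure_induction with
  | mem f h =>
    rcases h with ⟨i, rfl⟩ | ⟨i, rfl⟩
    · exact cs.preservesLeftEdges_antisort i
    · exact cs.preservesLeftEdges_sort i
  | one => exact fun w i hi => .inr ⟨rfl, hi⟩
  | mul f g _ _ hf hg => exact hf.comp hg

theorem bruhatLE_of_mem_biHecke {f : Function.End W} (hf : f ∈ cs.biHecke) {u v : W}
    (h : cs.BruhatLE u v) : cs.BruhatLE (f u) (f v) := by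
  rw [bruhatLE_iff_bruhatChain] at h ⊢
  induction hf using Submonoid.closure_induction generalizing u v with
  | mem f hf =>
    rcases hf with ⟨i, rfl⟩ | ⟨i, rfl⟩
    · exact h.map fun _ _ h => h.antisort i
    · exact h.map fun _ _ h => h.sort i
  | one => exact h
  | mul f g _ _ hf hg => exact hf (hg h)

theorem antisortWord_cons (i : B) (a : List B) :
    cs.antisortWord (i :: a) = cs.antisortWord a * cs.antisort i := rfl

theorem sortWord_cons (i : B) (a : List B) :
    cs.sortWord (i :: a) = cs.sortWord a * cs.sort i := rfl

theorem antisortWord_mem_biHecke (a : List B) : cs.antisortWord a ∈ cs.biHecke := by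
  induction a with
  | nil => exact one_mem _
  | cons i a ih => exact mul_mem ih (Submonoid.subset_closure (.inl ⟨i, rfl⟩))

theorem sortWord_mem_biHecke (a : List B) : cs.sortWord a ∈ cs.biHecke := by
  induction a with
  | nil => exact one_mem _
  | cons i a ih => exact mul_mem ih (Submonoid.subset_closure (.inr ⟨i, rfl⟩))

theorem antisortWord_apply_of_length {a : List B} {x : W}
    (h : cs.length (x * cs.wordProd a) = cs.length x + a.length) :
    cs.antisortWord a x = x * cs.wordProd a := by
  induction a generalizing x with
  | nil => simp [antisortWord]
  | cons i a ih =>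
    rw [wordProd_cons, ← mul_assoc, length_cons] at h
    have h1 := cs.length_mul_le (x * cs.simple i) (cs.wordProd a)
    have h2 := cs.length_wordProd_le a
    have h3 := cs.length_mul_simple x i
    have hi : ¬ cs.IsRightDescent x i := by rw [IsRightDescent]; lia
    have : cs.antisort i x = x * cs.simple i := by simp [antisort, hi]
    rw [antisortWord_cons, wordProd_cons, ← mul_assoc, ← ih (by lia), ← this]
    rfl

theorem sortWord_apply_of_length {a : List B} {x : W}
    (h : cs.length (x * cs.wordProd a) + a.length = cs.length x) :
    cs.sortWord a x = x * cs.wordProd a := by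
  induction a generalizing x with
  | nil => simp [sortWord]
  | cons i a ih =>
    rw [wordProd_cons, ← mul_assoc, length_cons] at h
    have h1 := cs.length_le_length_mul_add_right (x * cs.simple i) (cs.wordProd a)
    have h2 := cs.length_wordProd_le a
    have h3 := cs.length_mul_simple x i
    have hi : cs.IsRightDescent x i := by rw [IsRightDescent]; lia
    have : cs.sort i x = x * cs.simple i := by simp [sort, hi]
    rw [sortWord_cons, wordProd_cons, ← mul_assoc, ← ih (by lia), ← this]
    rfl

/-- Idempotence makes `f` the identity on its image; contraction towards `1` puts `f u` in the
intersection, and Bruhat monotonicity makes it an upper bound. -/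
theorem isBruhatMax_of_isIdempotentElem {f : Function.End W} (hf : f ∈ cs.biHecke)
    (hi : IsIdempotentElem f) {w : W} (hr : Set.range f = cs.leftInterval 1 w) (u : W) :
    cs.IsBruhatMax (cs.bruhatInterval 1 u ∩ cs.leftInterval 1 w) (f u) := by
  have hfix : ∀ x ∈ cs.leftInterval 1 w, f x = x := by
    rw [← hr]
    rintro _ ⟨y, rfl⟩
    exact congrFun hi y
  have h1 : f 1 = 1 := hfix 1 ⟨cs.one_leftLE 1, cs.one_leftLE w⟩
  refine ⟨⟨⟨cs.one_bruhatLE _, (cs.preservesLeftEdges_of_mem_biHecke hf).bruhatLE h1 u⟩,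
    hr ▸ ⟨u, rfl⟩⟩, ?_⟩
  rintro x ⟨hxu, hxw⟩
  rw [← hfix x hxw]
  exact cs.bruhatLE_of_mem_biHecke hf hxu.2

/-! ### The longest element -/

namespace IsLongest

variable {cs : CoxeterSystem M W} {w₀ : W} (hw₀ : cs.IsLongest w₀)
include hw₀

theorem isRightInversion {t : W} (ht : cs.IsReflection t) : cs.IsRightInversion w₀ t :=
  ⟨ht, lt_of_le_of_ne (hw₀ _) (ht.length_mul_left_ne _)⟩

theorem isRightDescent (i : B) : cs.IsRightDescent w₀ i :=
  (cs.isRightInversion_simple_iff_isRightDescent _ _).1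
    (hw₀.isRightInversion (cs.isReflection_simple i))

/-- Every reflection is an inversion of `w₀`, so by the cocycle rule the inversions of `w₀ x` are
the reflections that are not inversions of `x`. Each ascent of `x` is therefore a descent of `w₀ x`.
-/
theorem length_mul_add (x : W) : cs.length (w₀ * x) + cs.length x = cs.length w₀ := by
  obtain ⟨a, ha, rfl⟩ := cs.exists_isReduced x
  induction a using List.reverseRecOn with
  | nil => simp
  | append_singleton a i ih =>
    obtain ⟨ha', hi⟩ := cs.isReduced_of_concat ha
    have h := ih ha'
    have hd : cs.IsRightDescent (w₀ * cs.wordProd a) i := by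
      rw [← isRightInversion_simple_iff_isRightDescent, ← inversionParity_eq_one_iff,
        inversionParity_mul, cs.inversionParity_eq_one_iff.2
          (hw₀.isRightInversion ((cs.isReflection_simple i).conj _))]
      have : cs.inversionParity (cs.wordProd a) (cs.simple i) ≠ 1 := by
        rwa [Ne, inversionParity_eq_one_iff, isRightInversion_simple_iff_isRightDescent]
      generalize cs.inversionParity (cs.wordProd a) (cs.simple i) = y at this
      revert this; revert y; decide
    rw [isRightDescent_iff] at hd
    rw [not_isRightDescent_iff] at hi
    rw [wordProd_append, wordProd_singleton, ← mul_assoc]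
    lia

theorem mul_self : w₀ * w₀ = 1 := by
  have := hw₀.length_mul_add w₀
  rw [← cs.length_eq_zero_iff]
  lia

theorem inv_eq : w₀⁻¹ = w₀ := inv_eq_of_mul_eq_one_left hw₀.mul_self

theorem leftLE (u : W) : cs.LeftLE u w₀ := by
  rw [leftLE_iff, ← hw₀.length_mul_add u⁻¹, length_inv]

theorem antisortWord_apply (a : List B) : cs.antisortWord a w₀ = w₀ := by
  induction a with
  | nil => rfl
  | cons i a ih =>
    have : cs.antisort i w₀ = w₀ := by simp [antisort, hw₀.isRightDescent i]
    change cs.antisortWord a (cs.antisort i w₀) = w₀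
    rw [this, ih]

variable {w : W} {a b : List B} (ha : cs.IsReduced a) (ha' : cs.wordProd a = w⁻¹ * w₀)
  (hb : cs.IsReduced b) (hb' : cs.wordProd b = w₀ * w)
include hb hb'

theorem sortWord_antisortWord_apply_longest :
    (cs.sortWord b * cs.antisortWord a) w₀ = w := by
  have h := hw₀.length_mul_add w
  change cs.sortWord b (cs.antisortWord a w₀) = w
  rw [hw₀.antisortWord_apply,
    sortWord_apply_of_length, hb', ← mul_assoc, hw₀.mul_self, one_mul]
  rw [← hb.eq, hb', ← mul_assoc, hw₀.mul_self, one_mul, add_comm]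
  exact h

include ha ha'

theorem sortWord_antisortWord_apply {x : W} (hx : cs.LeftLE x w) :
    (cs.sortWord b * cs.antisortWord a) x = x := by
  rw [leftLE_iff] at hx
  have h1 := hw₀.length_mul_add w
  have h2 := hw₀.length_mul_add (w * x⁻¹)
  -- This form gives the length as `ℓ(w₀) - ℓ(w x⁻¹) = ℓ(w₀) - ℓ(w) + ℓ(x)`, so every letter of `a`
  -- raises the length and every letter of `b` lowers it.
  have e : x * cs.wordProd a = (w₀ * (w * x⁻¹))⁻¹ := by
    rw [ha', mul_inv_rev, mul_inv_rev, hw₀.inv_eq, inv_inv, mul_assoc]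
  have hla : cs.length (x * cs.wordProd a) = cs.length x + a.length := by
    rw [e, length_inv, ← ha.eq, ha', ← cs.length_inv (w⁻¹ * w₀), mul_inv_rev, inv_inv,
      hw₀.inv_eq]
    lia
  have e' : x * cs.wordProd a * cs.wordProd b = x := by
    rw [ha', hb', mul_assoc, mul_assoc w⁻¹, ← mul_assoc w₀, hw₀.mul_self, one_mul,
      inv_mul_cancel, mul_one]
  change cs.sortWord b (cs.antisortWord a x) = x
  rw [cs.antisortWord_apply_of_length hla,
    sortWord_apply_of_length, e']
  rw [e', e, length_inv, ← hb.eq, hb']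
  lia

theorem range_sortWord_antisortWord :
    Set.range (cs.sortWord b * cs.antisortWord a) = cs.leftInterval 1 w := by
  ext x
  constructor
  · rintro ⟨y, rfl⟩
    refine ⟨cs.one_leftLE _, ?_⟩
    -- Apply the map to `y ≤_L w₀`: left weak order is preserved and `w₀` goes to `w`.
    have h := (cs.preservesLeftEdges_of_mem_biHecke
      (mul_mem (cs.sortWord_mem_biHecke b) (cs.antisortWord_mem_biHecke a))).leftLE (hw₀.leftLE y)
    rwa [hw₀.sortWord_antisortWord_apply_longest hb hb'] at h
  · rintro ⟨-, hx⟩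
    exact ⟨x, hw₀.sortWord_antisortWord_apply ha ha' hb hb' hx⟩

theorem isIdempotentElem_sortWord_antisortWord :
    IsIdempotentElem (cs.sortWord b * cs.antisortWord a) := by
  funext y
  refine hw₀.sortWord_antisortWord_apply ha ha' hb hb' ?_
  have : (cs.sortWord b * cs.antisortWord a) y ∈ cs.leftInterval 1 w :=
    hw₀.range_sortWord_antisortWord ha ha' hb hb' ▸ ⟨y, rfl⟩
  exact this.2

end IsLongest

theorem eq_of_isIdempotentElem_of_range_eq {f g : Function.End W} (hf : f ∈ cs.biHecke)
    (hfi : IsIdempotentElem f) (hg : g ∈ cs.biHecke) (hgi : IsIdempotentElem g) {w : W}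
    (hfr : Set.range f = cs.leftInterval 1 w) (hgr : Set.range g = cs.leftInterval 1 w) :
    f = g :=
  funext fun u => (cs.isBruhatMax_of_isIdempotentElem hf hfi hfr u).unique
    (cs.isBruhatMax_of_isIdempotentElem hg hgi hgr u)

end CoxeterSystem

theorem mainTheorem5 {B W : Type*} [Group W] [Finite W] {M : CoxeterMatrix B}
    (cs : CoxeterSystem M W) (w₀ : W) (hw₀ : cs.IsLongest w₀) (w : W) :
    -- `e_w` does not depend on the reduced words used for `π_{w⁻¹ w₀}` and `π̄_{w₀ w}`
    (∀ a b : List B, cs.IsReduced a → cs.wordProd a = w⁻¹ * w₀ →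
      cs.IsReduced b → cs.wordProd b = w₀ * w →
      ∀ u : W, cs.sortWord b (cs.antisortWord a u) = cs.biHeckeIdem w₀ w u) ∧
    -- `e_w` is an idempotent of `M(W)` with image set `[1, w]_L`
    (cs.biHeckeIdem w₀ w ∈ cs.biHecke ∧
      IsIdempotentElem (cs.biHeckeIdem w₀ w) ∧
      Set.range (cs.biHeckeIdem w₀ w) = cs.leftInterval 1 w) ∧
    -- and it is the only one
    (∀ f : Function.End W, f ∈ cs.biHecke → IsIdempotentElem f →
      Set.range f = cs.leftInterval 1 w → f = cs.biHeckeIdem w₀ w) ∧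
    -- `e_w(u)` is the Bruhat maximum of `[1, u]_B ∩ [1, w]_L`
    (∀ u : W, cs.IsBruhatMax (cs.bruhatInterval 1 u ∩ cs.leftInterval 1 w)
      (cs.biHeckeIdem w₀ w u)) := by
  have hmem : ∀ a b : List B, cs.sortWord b * cs.antisortWord a ∈ cs.biHecke := fun a b =>
    mul_mem (cs.sortWord_mem_biHecke b) (cs.antisortWord_mem_biHecke a)
  obtain ⟨ha, ha'⟩ := cs.reducedWord_spec (w⁻¹ * w₀)
  obtain ⟨hb, hb'⟩ := cs.reducedWord_spec (w₀ * w)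
  have hm : cs.biHeckeIdem w₀ w ∈ cs.biHecke := hmem _ _
  have hi : IsIdempotentElem (cs.biHeckeIdem w₀ w) :=
    hw₀.isIdempotentElem_sortWord_antisortWord ha ha' hb hb'
  have hr : Set.range (cs.biHeckeIdem w₀ w) = cs.leftInterval 1 w :=
    hw₀.range_sortWord_antisortWord ha ha' hb hb'
  refine ⟨fun a b ha ha' hb hb' u => ?_, ⟨hm, hi, hr⟩, fun f hf hfi hfr =>
    cs.eq_of_isIdempotentElem_of_range_eq hf hfi hm hi hfr hr,
    cs.isBruhatMax_of_isIdempotentElem hm hi hr⟩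
  -- Any choice of reduced words gives an idempotent with the same image, so uniqueness replaces an
  -- argument with braid moves.
  exact congrFun (cs.eq_of_isIdempotentElem_of_range_eq (hmem a b)
    (hw₀.isIdempotentElem_sortWord_antisortWord ha ha' hb hb') hm hi
    (hw₀.range_sortWord_antisortWord ha ha' hb hb') hr) u
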